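/- Let $E = C[0,1]\otimes L_2(0,1)$, the Hilbert $C[0,1]$-module of norm-continuous maps $f\colon [0,1]\to L_2(0,1)$, $\pi\mapsto f_\pi$, with the pointwise action of $C[0,1]$ and the $C[0,1]$-valued inner product $\langle f,g\rangle(\pi)=\langle f_\pi,g_\pi\rangle$. Let $$D_0=\{f\in L_2(0,1): f \text{ absolutely continuous},\ f'\in L_2(0,1),\ f(0)=f(1)\},$$ $$D_{00}=\{f\in L_2(0,1): f \text{ absolutely continuous},\ f'\in L_2(0,1),\ f(0)=f(1)=0\},$$ and define an operator $t$ on $E$ by $$D(t)=\{f\in E: f_0\in D_{00},\ f_\pi\in D_0 \text{ for } 0<\pi\le 1,\ \pi\mapsto f_\pi' \text{ is continuous from } [0,1] \text{ to } L_2(0,1)\},\qquad (tf)(\pi)=i\,f_\pi'.$$ For a ($\mathbb C$-linear, not necessarily everywhere defined) operator $T$ from a Hilbert $A$-module $E$ to a Hilbert $A$-module $F$, with dense domain $D(T)$, let $T^*$ denote its adjoint: its domain consists of all $y\in F$ for which there is a $z\in E$ with $\langle Tx,y\rangle=\langle x,z\rangle$ for all $x\in D(T)$, and $T^*y=z$.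 Call $T$ semiregular if $D(T)$ is a dense $A$-submodule of $E$, $T$ is closable and $T^*$ is densely defined. Call $T$ regular if $T$ is closed and densely defined, $T^*$ is densely defined and the range of $I+T^*T$ is dense in $E$. **Proposition 2.2.** The operator $t$ is closed and semiregular, and it is not regular. -/

import Mathlib

open MeasureTheory Set Filter
open scoped ComplexOrder InnerProductSpace unitInterval

noncomputable section

namespace HilbertModule

/-! ### Unbounded operators between Hilbert C⋆-modules

Operators are `ℂ`-linear maps defined on a linear subspace (`LinearPMap`). The definitions need no
completeness; a Hilbert module is a complete `CStarModule`. In Mathlib's convention the inner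
product is linear in the second variable and the module action is written `a • x`. -/

section Operators

variable (A : Type*) {E F : Type*} [NonUnitalCStarAlgebra A] [PartialOrder A] [StarOrderedRing A]
  [NormedAddCommGroup E] [NormedSpace ℂ E] [SMul A E] [CStarModule A E]
  [NormedAddCommGroup F] [NormedSpace ℂ F] [SMul A F] [CStarModule A F]

/-- All pairs `(y, z)` in `F × E` such that `⟪T x, y⟫ = ⟪x, z⟫` for every `x` in the domain of `T`,
where the inner products are those with values in `A`. -/
def adjointGraph (T : E →ₗ.[ℂ] F) : Submodule ℂ (F × E) where
  carrier := {p | ∀ x : T.domain, ⟪T x, p.1⟫_A = ⟪(x : E), p.2⟫_A}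
  add_mem' := fun {p q} hp hq x => by
    simp only [Prod.fst_add, Prod.snd_add, CStarModule.inner_add_right]
    rw [hp x, hq x]
  zero_mem' := fun x => by simp
  smul_mem' := fun c p hp x => by
    simp only [Prod.smul_fst, Prod.smul_snd, CStarModule.inner_smul_right_complex]
    rw [hp x]

/-- The adjoint `T⋆` of a densely defined operator `T`. Its domain consists of all `y` for which
there is a `z` with `⟪T x, y⟫ = ⟪x, z⟫` for all `x` in the domain of `T`, and `T⋆ y = z`
(for a densely defined `T` this `z` is unique, see `adjoint_graph`; the domain is the stated one
for every `T`). -/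
def adjoint (T : E →ₗ.[ℂ] F) : F →ₗ.[ℂ] E :=
  (adjointGraph A T).toLinearPMap

theorem adjoint_graph (T : E →ₗ.[ℂ] F) (hT : Dense (T.domain : Set E)) :
    (adjoint A T).graph = adjointGraph A T := by
  refine Submodule.toLinearPMap_graph_eq _ ?_
  rintro ⟨y, z⟩ hyz hy
  obtain rfl : y = 0 := hy
  have h : ∀ x : E, ⟪x, z⟫_A = 0 := by
    intro x
    have hc : Continuous fun x : E => ⟪x, z⟫_A :=
      CStarModule.continuous_inner.comp (Continuous.prodMk continuous_id continuous_const)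
    refine congrFun (hc.ext_on hT continuous_const ?_) x
    intro w hw
    have := hyz ⟨w, hw⟩
    simpa using this.symm
  exact CStarModule.inner_self.1 (h z)

/-- Semiregular operators: the domain is a dense `A`-submodule, the operator is closable, and the
adjoint is densely defined. -/
structure IsSemiregular (T : E →ₗ.[ℂ] F) : Prop where
  dense_domain : Dense (T.domain : Set E)
  smul_mem_domain : ∀ (a : A), ∀ x ∈ T.domain, a • x ∈ T.domain
  isClosable : T.IsClosable
  dense_adjoint_domain : Dense ((adjoint A T).domain : Set F)

/-- The range of `I + T⋆ T`, where the domain of `T⋆ T` consists of all `x` in the domain of `T`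
such that `T x` lies in the domain of `T⋆`. -/
def rangeOneAddAdjointMul (T : E →ₗ.[ℂ] F) : Set E :=
  {z | ∃ (x : T.domain) (hx : T x ∈ (adjoint A T).domain), z = x + adjoint A T ⟨T x, hx⟩}

/-- Regular operators: closed, densely defined, with densely defined adjoint, and such that
`I + T⋆ T` has dense range. -/
structure IsRegular (T : E →ₗ.[ℂ] F) : Prop where
  isClosed : T.IsClosed
  dense_domain : Dense (T.domain : Set E)
  dense_adjoint_domain : Dense ((adjoint A T).domain : Set F)
  dense_range : Dense (rangeOneAddAdjointMul A T)

end Operators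

/-! ### The Hilbert `C[0,1]`-module `C[0,1] ⊗ L₂(0,1)` -/

/-- The Hilbert space `L₂(0,1)`. -/
abbrev L2 : Type := Lp ℂ 2 (volume.restrict (Ioo (0 : ℝ) 1))

/-- The Hilbert module `C[0,1] ⊗ L₂(0,1)`, realised as the space of norm continuous functions
`π ↦ f π` from `[0,1]` to `L₂(0,1)` with the supremum norm. The elementary tensor `a ⊗ h` is the
function `π ↦ a π • h`; `inner_tensor` and `dense_span_tensor` below, together with completeness,
say that this is the completion of the algebraic tensor product for the inner product
`⟪a ⊗ h, b ⊗ k⟫ = ⟪h, k⟫ • (star a * b)`. The action of `C[0,1]` is pointwise multiplication. -/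
abbrev ModuleE : Type := C(I, L2)

/-- The `C[0,1]`-valued inner product `⟪f, g⟫ (π) = ⟪f π, g π⟫`. -/
instance instInnerModuleE : Inner C(I, ℂ) ModuleE where
  inner f g := ⟨fun p => ⟪f p, g p⟫_ℂ, by fun_prop⟩

theorem inner_apply (f g : ModuleE) (p : I) : ⟪f, g⟫_C(I, ℂ) p = ⟪f p, g p⟫_ℂ := rfl

instance instCStarModuleModuleE : CStarModule C(I, ℂ) ModuleE where
  inner_add_right {f g h} := by
    ext p
    simp [inner_apply, inner_add_right]
  inner_self_nonneg {f} := fun p => by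
    change (0 : ℂ) ≤ ⟪f p, f p⟫_ℂ
    rw [inner_self_eq_norm_sq_to_K]
    change (0 : ℂ) ≤ (Complex.ofReal ‖f p‖) ^ 2
    rw [← Complex.ofReal_pow]
    exact Complex.zero_le_real.2 (sq_nonneg ‖f p‖)
  inner_self {f} := by
    constructor
    · intro h
      refine ContinuousMap.ext fun p => ?_
      have := congrArg (fun u : C(I, ℂ) => u p) h
      simpa [inner_apply] using this
    · rintro rfl
      ext p
      simp [inner_apply]
  inner_op_smul_right {a f g} := by
    ext p
    simp [inner_apply, inner_smul_right]
  inner_smul_right_complex {z f g} := by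
    ext p
    simp [inner_apply, inner_smul_right]
  star_inner f g := by
    ext p
    simp [inner_apply]
  norm_eq_sqrt_norm_inner_self f := by
    refine le_antisymm ?_ ?_
    · refine (ContinuousMap.norm_le _ (Real.sqrt_nonneg _)).2 fun p => ?_
      refine Real.le_sqrt_of_sq_le ?_
      have := ContinuousMap.norm_coe_le_norm (⟪f, f⟫_C(I, ℂ)) p
      rw [inner_apply, inner_self_eq_norm_sq_to_K] at this
      simpa using this
    · refine Real.sqrt_le_iff.2 ⟨norm_nonneg _, ?_⟩
      refine (ContinuousMap.norm_le _ (sq_nonneg _)).2 fun p => ?_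
      have := ContinuousMap.norm_coe_le_norm f p
      rw [inner_apply, inner_self_eq_norm_sq_to_K]
      simp only [Complex.coe_algebraMap, norm_pow, Complex.norm_real, norm_norm]
      gcongr

/-- The elementary tensor `a ⊗ h`. -/
def tensor (a : C(I, ℂ)) (h : L2) : ModuleE := ⟨fun p => a p • h, by fun_prop⟩

theorem inner_tensor (a b : C(I, ℂ)) (h k : L2) :
    ⟪tensor a h, tensor b k⟫_C(I, ℂ) = ⟪h, k⟫_ℂ • (star a * b) := by
  ext p
  simp only [inner_apply, tensor, ContinuousMap.coe_mk, inner_smul_left, inner_smul_right,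
    ContinuousMap.smul_apply, ContinuousMap.mul_apply, ContinuousMap.star_apply, smul_eq_mul,
    starRingEnd_apply]
  ring

theorem dense_span_tensor :
    Dense (Submodule.span ℂ {f : ModuleE | ∃ a h, f = tensor a h} : Set ModuleE) := by
  intro f
  refine mem_closure_of_tendsto (bernsteinApproximation_uniform f) (.of_forall fun n => ?_)
  have : bernsteinApproximation n f = ∑ k : Fin (n + 1),
      tensor ⟨fun p => ((bernstein n k p : ℝ) : ℂ), by fun_prop⟩ (f (bernstein.z k)) := by
    ext1 p
    rw [bernsteinApproximation.apply, ContinuousMap.sum_apply]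
    exact Finset.sum_congr rfl fun k _ => (Complex.coe_smul _ _).symm
  rw [this]
  exact Submodule.sum_mem _ fun k _ => Submodule.subset_span ⟨_, _, rfl⟩

/-! ### Absolutely continuous functions in `L₂(0,1)` -/

/-- `F` is an absolutely continuous function on `[0,1]` that represents `f ∈ L₂(0,1)`, and
its almost everywhere derivative represents `g ∈ L₂(0,1)`. -/
structure IsACRep (F : ℝ → ℂ) (f g : L2) : Prop where
  absCont : AbsolutelyContinuousOnInterval F 0 1
  ae_eq : ∀ᵐ x ∂(volume.restrict (Ioo (0 : ℝ) 1)), f x = F x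
  hasDerivAt : ∀ᵐ x ∂(volume.restrict (Ioo (0 : ℝ) 1)), HasDerivAt F (g x) x

namespace IsACRep

variable {F F₁ F₂ : ℝ → ℂ} {f g f₁ g₁ f₂ g₂ : L2}

theorem zero : IsACRep 0 0 0 where
  absCont := by
    simpa [AbsolutelyContinuousOnInterval] using! tendsto_const_nhds
  ae_eq := Lp.coeFn_zero _ _ _
  hasDerivAt := by
    filter_upwards [Lp.coeFn_zero ℂ 2 (volume.restrict (Ioo (0 : ℝ) 1))] with x hx
    rw [hx]
    exact hasDerivAt_const x 0

theorem add (h₁ : IsACRep F₁ f₁ g₁) (h₂ : IsACRep F₂ f₂ g₂) :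
    IsACRep (F₁ + F₂) (f₁ + f₂) (g₁ + g₂) where
  absCont := h₁.absCont.add h₂.absCont
  ae_eq := by
    filter_upwards [h₁.ae_eq, h₂.ae_eq, Lp.coeFn_add f₁ f₂] with x hx₁ hx₂ hx
    rw [hx, Pi.add_apply, hx₁, hx₂, Pi.add_apply]
  hasDerivAt := by
    filter_upwards [h₁.hasDerivAt, h₂.hasDerivAt, Lp.coeFn_add g₁ g₂] with x hx₁ hx₂ hx
    rw [hx, Pi.add_apply]
    exact hx₁.add hx₂

theorem smul (c : ℂ) (h : IsACRep F f g) : IsACRep (c • F) (c • f) (c • g) where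
  absCont := h.absCont.const_smul c
  ae_eq := by
    filter_upwards [h.ae_eq, Lp.coeFn_smul c f] with x hx₁ hx
    rw [hx, Pi.smul_apply, hx₁, Pi.smul_apply]
  hasDerivAt := by
    filter_upwards [h.hasDerivAt, Lp.coeFn_smul c g] with x hx₁ hx
    rw [hx, Pi.smul_apply]
    exact hx₁.const_smul c

theorem eqOn (h₁ : IsACRep F₁ f g₁) (h₂ : IsACRep F₂ f g₂) : EqOn F₁ F₂ (Icc 0 1) := by
  have c₁ : ContinuousOn F₁ (Icc 0 1) := by
    simpa [uIcc_of_le zero_le_one] using h₁.absCont.continuousOn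
  have c₂ : ContinuousOn F₂ (Icc 0 1) := by
    simpa [uIcc_of_le zero_le_one] using h₂.absCont.continuousOn
  refine Measure.eqOn_Icc_of_ae_eq volume zero_ne_one ?_ c₁ c₂
  rw [← Measure.restrict_congr_set Ioo_ae_eq_Icc]
  filter_upwards [h₁.ae_eq, h₂.ae_eq] with x hx₁ hx₂
  rw [← hx₁, hx₂]

theorem unique (h₁ : IsACRep F₁ f g₁) (h₂ : IsACRep F₂ f g₂) : g₁ = g₂ := by
  refine Lp.ext ?_
  filter_upwards [h₁.hasDerivAt, h₂.hasDerivAt, ae_restrict_mem measurableSet_Ioo]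
    with x hx₁ hx₂ hx
  refine hx₁.unique (hx₂.congr_of_eventuallyEq ?_)
  filter_upwards [Ioo_mem_nhds hx.1 hx.2] with y hy
  exact h₁.eqOn h₂ (Ioo_subset_Icc_self hy)

end IsACRep

/-- The absolutely continuous functions `f ∈ L₂(0,1)` with `f' ∈ L₂(0,1)` and `f 0 = f 1`. -/
def D0 : Submodule ℂ L2 where
  carrier := {f | ∃ F g, IsACRep F f g ∧ F 0 = F 1}
  zero_mem' := ⟨0, 0, .zero, rfl⟩
  add_mem' := by
    rintro _ _ ⟨F₁, g₁, h₁, e₁⟩ ⟨F₂, g₂, h₂, e₂⟩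
    exact ⟨_, _, h₁.add h₂, by simp [e₁, e₂]⟩
  smul_mem' := by
    rintro c _ ⟨F, g, h, e⟩
    exact ⟨_, _, h.smul c, by simp [e]⟩

/-- The absolutely continuous functions `f ∈ L₂(0,1)` with `f' ∈ L₂(0,1)` and
`f 0 = f 1 = 0`. -/
def D00 : Submodule ℂ L2 where
  carrier := {f | ∃ F g, IsACRep F f g ∧ F 0 = 0 ∧ F 1 = 0}
  zero_mem' := ⟨0, 0, .zero, rfl, rfl⟩
  add_mem' := by
    rintro _ _ ⟨F₁, g₁, h₁, e₁, e₁'⟩ ⟨F₂, g₂, h₂, e₂, e₂'⟩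
    exact ⟨_, _, h₁.add h₂, by simp [e₁, e₂], by simp [e₁', e₂']⟩
  smul_mem' := by
    rintro c _ ⟨F, g, h, e, e'⟩
    exact ⟨_, _, h.smul c, by simp [e], by simp [e']⟩

open Classical in
/-- The derivative `f' ∈ L₂(0,1)` of an absolutely continuous function `f` with `f' ∈ L₂(0,1)`
(and `0` for all other `f`); see `acDeriv_eq`. -/
def acDeriv (f : L2) : L2 := if h : ∃ g F, IsACRep F f g then h.choose else 0

theorem acDeriv_eq {F : ℝ → ℂ} {f g : L2} (h : IsACRep F f g) : acDeriv f = g := by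
  have hex : ∃ g F, IsACRep F f g := ⟨g, F, h⟩
  rw [acDeriv, dif_pos hex]
  exact hex.choose_spec.choose_spec.unique h

theorem acDeriv_add {f₁ f₂ : L2} (h₁ : f₁ ∈ D0) (h₂ : f₂ ∈ D0) :
    acDeriv (f₁ + f₂) = acDeriv f₁ + acDeriv f₂ := by
  obtain ⟨F₁, g₁, h₁, -⟩ := h₁
  obtain ⟨F₂, g₂, h₂, -⟩ := h₂
  rw [acDeriv_eq h₁, acDeriv_eq h₂, acDeriv_eq (h₁.add h₂)]

theorem acDeriv_smul (c : ℂ) {f : L2} (h : f ∈ D0) : acDeriv (c • f) = c • acDeriv f := by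
  obtain ⟨F, g, h, -⟩ := h
  rw [acDeriv_eq h, acDeriv_eq (h.smul c)]

theorem D00_le_D0 : D00 ≤ D0 := by
  rintro f ⟨F, g, h, e, e'⟩
  exact ⟨F, g, h, e.trans e'.symm⟩

/-! ### The operator -/

theorem mem_D0_of_fibres {f : ModuleE} (h₀ : f 0 ∈ D00) (h : ∀ p : I, 0 < p → f p ∈ D0) (p : I) :
    f p ∈ D0 := by
  rcases eq_or_lt_of_le (show (0 : I) ≤ p from p.2.1) with hp | hp
  · rw [← hp]
    exact D00_le_D0 h₀
  · exact h p hp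

/-- The domain of `t`: all `f ∈ E` with `f 0 ∈ D00`, with `f π ∈ D0` for `0 < π ≤ 1`, and such
that `π ↦ (f π)'` is a continuous map from `[0,1]` to `L₂(0,1)`. -/
def tDomain : Submodule ℂ ModuleE where
  carrier := {f | f 0 ∈ D00 ∧ (∀ p : I, 0 < p → f p ∈ D0) ∧ Continuous fun p => acDeriv (f p)}
  zero_mem' := by
    refine ⟨D00.zero_mem, fun p _ => D0.zero_mem, ?_⟩
    simp only [ContinuousMap.zero_apply]
    exact continuous_const
  add_mem' := by
    rintro f g ⟨hf₀, hf, hf'⟩ ⟨hg₀, hg, hg'⟩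
    refine ⟨D00.add_mem hf₀ hg₀, fun p hp => D0.add_mem (hf p hp) (hg p hp), ?_⟩
    refine (hf'.add hg').congr fun p => ?_
    exact (acDeriv_add (mem_D0_of_fibres hf₀ hf p) (mem_D0_of_fibres hg₀ hg p)).symm
  smul_mem' := by
    rintro c f ⟨hf₀, hf, hf'⟩
    refine ⟨D00.smul_mem c hf₀, fun p hp => D0.smul_mem c (hf p hp), ?_⟩
    refine (hf'.const_smul c).congr fun p => ?_
    exact (acDeriv_smul c (mem_D0_of_fibres hf₀ hf p)).symm

/-- The operator `t` on `E = C[0,1] ⊗ L₂(0,1)` given by `(t f) (π) = i (f π)'`. -/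
def t : ModuleE →ₗ.[ℂ] ModuleE where
  domain := tDomain
  toFun :=
    { toFun := fun f => ⟨fun p => Complex.I • acDeriv ((f : ModuleE) p),
        f.2.2.2.const_smul Complex.I⟩
      map_add' := fun f g => by
        ext1 p
        change Complex.I • acDeriv ((f : ModuleE) p + (g : ModuleE) p) =
          Complex.I • acDeriv ((f : ModuleE) p) + Complex.I • acDeriv ((g : ModuleE) p)
        rw [acDeriv_add (mem_D0_of_fibres f.2.1 f.2.2.1 p) (mem_D0_of_fibres g.2.1 g.2.2.1 p),
          smul_add]
      map_smul' := fun c f => by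
        ext1 p
        change Complex.I • acDeriv (c • (f : ModuleE) p) =
          c • Complex.I • acDeriv ((f : ModuleE) p)
        rw [acDeriv_smul c (mem_D0_of_fibres f.2.1 f.2.2.1 p), smul_comm] }

end HilbertModule

end

noncomputable section

/-! In the fibre at `π`, `t` is `i d/dx`, with Dirichlet conditions at `π = 0` and periodic ones at
`π > 0`. Both L₂ operators have closed graphs, since integration by parts against test functions
characterises them (`isACRep_periodic_iff`, `isACRep_dirichlet_iff`). The graph of `t` is cut out by
these fibrewise conditions, so `t` is closed. All `a ⊗ h` with `h ∈ D00` lie in the domains of `t`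
and of its adjoint, which gives density.

Regularity fails at `π = 0`. By continuity in `π`, an element of the domain of `t⋆` keeps the
periodic condition there, although the adjoint of the Dirichlet operator imposes none
(`inner_fibre_zero_of_mem_adjointGraph`). So at `0` the operator `1 + t⋆t` is `f ↦ f - f''` with one
boundary condition too many, and its range is orthogonal to `exp x + exp (1 - x)`. -/

/-! ### Complex-valued absolutely continuous functions. -/

theorem AbsolutelyContinuousOnInterval.conj {F : ℝ → ℂ} {a b : ℝ}
    (h : AbsolutelyContinuousOnInterval F a b) :
    AbsolutelyContinuousOnInterval (fun x => (starRingEnd ℂ) (F x)) a b := by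
  simpa only [AbsolutelyContinuousOnInterval, Complex.dist_conj_conj] using h

theorem AbsolutelyContinuousOnInterval.ofReal {F : ℝ → ℝ} {a b : ℝ}
    (h : AbsolutelyContinuousOnInterval F a b) :
    AbsolutelyContinuousOnInterval (fun x => (F x : ℂ)) a b := by
  simpa only [AbsolutelyContinuousOnInterval, Complex.dist_eq, ← Complex.ofReal_sub,
    Complex.norm_real, Real.dist_eq, Real.norm_eq_abs] using h

theorem AbsolutelyContinuousOnInterval.congr {F G : ℝ → ℂ} {a b : ℝ}
    (h : AbsolutelyContinuousOnInterval F a b) (e : EqOn F G (uIcc a b)) :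
    AbsolutelyContinuousOnInterval G a b := by
  refine Tendsto.congr' (eventually_inf_principal.2 (Eventually.of_forall fun S hS => ?_)) h
  refine Finset.sum_congr rfl fun i hi => ?_
  rw [e (hS.1 i hi).1, e (hS.1 i hi).2]

theorem IntervalIntegrable.absolutelyContinuousOnInterval_integral_complex {g : ℝ → ℂ} {a b : ℝ}
    (hg : IntervalIntegrable g volume a b) :
    AbsolutelyContinuousOnInterval (fun x => ∫ v in a..x, g v) a b := by
  have hre : IntervalIntegrable (fun x => (g x).re) volume a b := ⟨hg.1.re, hg.2.re⟩
  have him : IntervalIntegrable (fun x => (g x).im) volume a b := ⟨hg.1.im, hg.2.im⟩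
  refine ((hre.absolutelyContinuousOnInterval_intervalIntegral left_mem_uIcc).ofReal.add
    ((him.absolutelyContinuousOnInterval_intervalIntegral left_mem_uIcc).ofReal.const_smul
      Complex.I)).congr fun x hx => ?_
  have hx' : uIcc a x ⊆ uIcc a b := uIcc_subset_uIcc_left hx
  have h₁ : IntervalIntegrable (fun x => ((g x).re : ℂ)) volume a x :=
    ⟨(hre.mono_set hx').1.ofReal, (hre.mono_set hx').2.ofReal⟩
  have h₂ : IntervalIntegrable (fun x => ((g x).im : ℂ)) volume a x :=
    ⟨(him.mono_set hx').1.ofReal, (him.mono_set hx').2.ofReal⟩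
  simp only [Pi.add_apply, ← intervalIntegral.integral_ofReal,
    ← intervalIntegral.integral_smul]
  refine (intervalIntegral.integral_add h₁ (h₂.smul Complex.I)).symm.trans ?_
  refine intervalIntegral.integral_congr fun y _ => ?_
  simp [mul_comm Complex.I, Complex.re_add_im]

/-- The fundamental theorem of calculus for complex valued absolutely continuous functions. -/
theorem AbsolutelyContinuousOnInterval.integral_eq_sub_of_ae_hasDerivAt {F g : ℝ → ℂ} {a b : ℝ}
    (hF : AbsolutelyContinuousOnInterval F a b) (hg : IntervalIntegrable g volume a b)
    (hd : ∀ᵐ x, x ∈ uIcc a b → HasDerivAt F (g x) x) :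
    ∫ x in a..b, g x = F b - F a := by
  -- `F` minus the primitive of `g` has zero derivative almost everywhere, hence is constant.
  obtain ⟨C, hC⟩ := (hF.sub
    hg.absolutelyContinuousOnInterval_integral_complex).const_of_ae_hasDerivAt_zero (by
      filter_upwards [hd, hg.ae_hasDerivAt_integral] with x h₁ h₂ hx
      simpa using! (h₁ hx).sub (h₂ hx a left_mem_uIcc))
  have ha := hC a left_mem_uIcc
  have hb := hC b right_mem_uIcc
  simp only [Pi.sub_apply, intervalIntegral.integral_same, sub_zero] at ha hb
  rw [ha, ← hb]
  ring

namespace HilbertModule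

/-! ### Weak derivatives and boundary conditions in L₂(0,1). -/

theorem memLp_of_continuousOn_Icc {F : ℝ → ℂ} (hF : ContinuousOn F (Icc 0 1)) :
    MemLp F 2 (volume.restrict (Ioo (0 : ℝ) 1)) := by
  obtain ⟨C, hC⟩ := isCompact_Icc.exists_bound_of_continuousOn hF
  refine MemLp.of_bound
    ((hF.mono Ioo_subset_Icc_self).aestronglyMeasurable measurableSet_Ioo) C ?_
  filter_upwards [ae_restrict_mem measurableSet_Ioo] with x hx
  exact hC x (Ioo_subset_Icc_self hx)

/-- The element of `L₂(0,1)` represented by a continuous function. -/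
def ofContinuous (F : ℝ → ℂ) (hF : Continuous F) : L2 :=
  (memLp_of_continuousOn_Icc hF.continuousOn).toLp F

theorem coeFn_ofContinuous {F : ℝ → ℂ} (hF : Continuous F) :
    ofContinuous F hF =ᵐ[volume.restrict (Ioo (0 : ℝ) 1)] F :=
  MemLp.coeFn_toLp _

theorem isACRep_ofContinuous {F F' : ℝ → ℂ} (hF : Continuous F) (hF' : Continuous F')
    (h : ∀ x, HasDerivAt F (F' x) x) :
    IsACRep F (ofContinuous F hF) (ofContinuous F' hF') where
  absCont := by
    refine ContDiffOn.absolutelyContinuousOnInterval (ContDiff.contDiffOn ?_)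
    rw [contDiff_one_iff_deriv]
    refine ⟨fun x => (h x).differentiableAt, ?_⟩
    rwa [show deriv F = F' from funext fun x => (h x).deriv]
  ae_eq := coeFn_ofContinuous hF
  hasDerivAt := by
    filter_upwards [coeFn_ofContinuous hF'] with x hx
    rw [hx]
    exact h x

theorem intervalIntegrable_coeFn (g : L2) : IntervalIntegrable g volume 0 1 := by
  rw [intervalIntegrable_iff_integrableOn_Ioo_of_le zero_le_one]
  exact (Lp.memLp g).integrable one_le_two

theorem ae_mem_uIcc_of_ae_restrict {P : ℝ → Prop}
    (h : ∀ᵐ x ∂(volume.restrict (Ioo (0 : ℝ) 1)), P x) :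
    ∀ᵐ x, x ∈ uIcc (0 : ℝ) 1 → P x := by
  rw [Measure.restrict_congr_set Ioo_ae_eq_Icc, ae_restrict_iff' measurableSet_Icc] at h
  simpa only [uIcc_of_le (zero_le_one' ℝ)] using h

theorem exists_isACRep_antideriv (g : L2) : ∃ F f, IsACRep F f g ∧ F 0 = 0 := by
  have hg := intervalIntegrable_coeFn g
  have hF := hg.absolutelyContinuousOnInterval_integral_complex
  have hc : ContinuousOn (fun x => ∫ v in (0 : ℝ)..x, g v) (Icc 0 1) := by
    simpa only [uIcc_of_le (zero_le_one' ℝ)] using hF.continuousOn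
  refine ⟨_, (memLp_of_continuousOn_Icc hc).toLp _, ⟨hF, MemLp.coeFn_toLp _, ?_⟩,
    intervalIntegral.integral_same⟩
  filter_upwards [ae_restrict_of_ae hg.ae_hasDerivAt_integral, ae_restrict_mem measurableSet_Ioo]
    with x hx hx'
  rw [uIcc_of_le zero_le_one] at hx
  exact hx (Ioo_subset_Icc_self hx') 0 (left_mem_Icc.2 zero_le_one)

/-- Integration by parts. -/
theorem IsACRep.inner_add_inner {F H : ℝ → ℂ} {f g h k : L2} (hF : IsACRep F f g)
    (hH : IsACRep H h k) :
    ⟪g, h⟫_ℂ + ⟪f, k⟫_ℂ =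
      (starRingEnd ℂ) (F 1) * H 1 - (starRingEnd ℂ) (F 0) * H 0 := by
  have hint : Integrable (fun x => ⟪g x, h x⟫_ℂ + ⟪f x, k x⟫_ℂ)
      (volume.restrict (Ioo (0 : ℝ) 1)) :=
    (L2.integrable_inner g h).add (L2.integrable_inner f k)
  have := (hF.absCont.conj.smul hH.absCont).integral_eq_sub_of_ae_hasDerivAt
    (g := fun x => ⟪g x, h x⟫_ℂ + ⟪f x, k x⟫_ℂ)
    ((intervalIntegrable_iff_integrableOn_Ioo_of_le zero_le_one).2 hint)
    (ae_mem_uIcc_of_ae_restrict (by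
      filter_upwards [hF.ae_eq, hF.hasDerivAt, hH.ae_eq, hH.hasDerivAt] with x h₁ h₂ h₃ h₄
      rw [h₁, h₃]
      convert! h₂.star.mul h₄ using 1
      simp [RCLike.inner_apply, mul_comm]))
  rw [L2.inner_def, L2.inner_def, ← integral_add (L2.integrable_inner g h)
    (L2.integrable_inner f k), ← integral_Ioc_eq_integral_Ioo,
    ← intervalIntegral.integral_of_le zero_le_one, this]
  simp

theorem isACRep_one :
    IsACRep (fun _ => 1) (ofContinuous (fun _ => 1) continuous_const)
      (ofContinuous (fun _ => 0) continuous_const) :=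
  isACRep_ofContinuous _ _ fun x => hasDerivAt_const x 1

theorem isACRep_id :
    IsACRep (fun x => x) (ofContinuous (fun x => x) Complex.continuous_ofReal)
      (ofContinuous (fun _ => 1) continuous_const) :=
  isACRep_ofContinuous _ _ fun _ => HasDerivAt.ofReal_comp (hasDerivAt_id _)

theorem ofContinuous_zero : ofContinuous (fun _ => 0) continuous_const = 0 :=
  Lp.ext ((coeFn_ofContinuous _).trans (Lp.coeFn_zero ℂ 2 _).symm)

/-- A weak derivative in `L₂(0,1)` is the derivative of an absolutely continuous function. -/
theorem exists_isACRep_of_weak {f g : L2}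
    (hw : ∀ H h k, IsACRep H h k → H 0 = 0 → H 1 = 0 → ⟪k, f⟫_ℂ + ⟪h, g⟫_ℂ = 0) :
    ∃ F, IsACRep F f g := by
  obtain ⟨G, v, hG, -⟩ := exists_isACRep_antideriv g
  set e := ofContinuous (fun _ => 1) continuous_const
  -- `f` differs from a primitive of `g` by a constant: a `k` orthogonal to constants has a
  -- primitive vanishing at both ends, which is an admissible test function.
  have hmem : f - v ∈ Submodule.span ℂ {e} := by
    rw [← Submodule.orthogonal_orthogonal (Submodule.span ℂ {e})]
    refine (Submodule.mem_orthogonal _ _).2 fun k hk => ?_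
    rw [Submodule.mem_orthogonal_singleton_iff_inner_right] at hk
    obtain ⟨H, h, hH, hH₀⟩ := exists_isACRep_antideriv k
    have h₁ := isACRep_one.inner_add_inner hH
    rw [hk, ofContinuous_zero, hH₀] at h₁
    have hH₁ : H 1 = 0 := by simpa using h₁.symm
    have h₂ := hH.inner_add_inner hG
    rw [hH₀, hH₁, map_zero, zero_mul, zero_mul, sub_zero] at h₂
    have h₃ := hw H h k hH hH₀ hH₁
    rw [inner_sub_right]
    linear_combination h₃ - h₂
  obtain ⟨c, hc⟩ := Submodule.mem_span_singleton.1 hmem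
  have := hG.add (isACRep_one.smul c)
  rw [ofContinuous_zero, smul_zero, add_zero, hc, add_sub_cancel] at this
  exact ⟨_, this⟩

/-- Periodicity cancels the boundary terms; conversely, the test function `1` yields `F 1 - F 0 =
0`. -/
theorem isACRep_periodic_iff {f g : L2} :
    (∃ F, IsACRep F f g ∧ F 0 = F 1) ↔
      ∀ H h k, IsACRep H h k → H 0 = H 1 → ⟪k, f⟫_ℂ + ⟪h, g⟫_ℂ = 0 := by
  constructor
  · rintro ⟨F, hF, e⟩ H h k hH e'
    rw [hH.inner_add_inner hF, e, e', sub_self]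
  · intro hw
    obtain ⟨F, hF⟩ := exists_isACRep_of_weak fun H h k hH h₀ h₁ => hw H h k hH (h₀.trans h₁.symm)
    refine ⟨F, hF, ?_⟩
    have h₁ := isACRep_one.inner_add_inner hF
    rw [hw _ _ _ isACRep_one rfl] at h₁
    simpa [eq_comm (a := (0 : ℂ)), sub_eq_zero, eq_comm (a := F 1)] using h₁

/-- With no condition on the test functions, `x` detects `F 1` and then `1` detects `F 0`. -/
theorem isACRep_dirichlet_iff {f g : L2} :
    (∃ F, IsACRep F f g ∧ F 0 = 0 ∧ F 1 = 0) ↔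
      ∀ H h k, IsACRep H h k → ⟪k, f⟫_ℂ + ⟪h, g⟫_ℂ = 0 := by
  constructor
  · rintro ⟨F, hF, e₀, e₁⟩ H h k hH
    rw [hH.inner_add_inner hF, e₀, e₁, mul_zero, mul_zero, sub_self]
  · intro hw
    obtain ⟨F, hF⟩ := exists_isACRep_of_weak fun H h k hH _ _ => hw H h k hH
    have h₁ := isACRep_one.inner_add_inner hF
    rw [hw _ _ _ isACRep_one] at h₁
    have h₂ := isACRep_id.inner_add_inner hF
    rw [hw _ _ _ isACRep_id] at h₂
    have e₁ : F 1 = 0 := by simpa using h₂.symm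
    refine ⟨F, hF, ?_, e₁⟩
    simpa [e₁] using h₁.symm

/-- In weak form the graph is an intersection of zero sets of continuous functions. -/
theorem isClosed_periodic_graph :
    IsClosed {q : L2 × L2 | ∃ F, IsACRep F q.1 q.2 ∧ F 0 = F 1} := by
  simp only [isACRep_periodic_iff, ofPred_forall]
  exact isClosed_iInter fun H => isClosed_iInter fun h => isClosed_iInter fun k =>
    isClosed_iInter fun _ => isClosed_iInter fun _ => isClosed_eq (by fun_prop) continuous_const

theorem isClosed_dirichlet_graph :
    IsClosed {q : L2 × L2 | ∃ F, IsACRep F q.1 q.2 ∧ F 0 = 0 ∧ F 1 = 0} := by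
  simp only [isACRep_dirichlet_iff, ofPred_forall]
  exact isClosed_iInter fun H => isClosed_iInter fun h => isClosed_iInter fun k =>
    isClosed_iInter fun _ => isClosed_eq (by fun_prop) continuous_const

theorem dense_D00 : Dense (D00 : Set L2) := by
  rw [Submodule.dense_iff_topologicalClosure_eq_top, Submodule.topologicalClosure_eq_top_iff,
    Submodule.eq_bot_iff]
  intro u hu
  rw [Submodule.mem_orthogonal] at hu
  -- `D00` contains all smooth functions compactly supported in the open interval, so the
  -- fundamental lemma of the calculus of variations applies.
  have key : ∀ᵐ x ∂(volume.restrict (Ioo (0 : ℝ) 1)), x ∈ Ioo (0 : ℝ) 1 → u x = 0 := by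
    refine isOpen_Ioo.ae_eq_zero_of_integral_contDiff_smul_eq_zero
      (((Lp.memLp u).integrable one_le_two).locallyIntegrable.locallyIntegrableOn _) ?_
    intro g hg _ hsupp
    have hg₁ : ContDiff ℝ 1 g := hg.of_le (by simp)
    have hd : Continuous fun x => ((deriv g x : ℝ) : ℂ) :=
      Complex.continuous_ofReal.comp (hg₁.continuous_deriv le_rfl)
    have hrep := isACRep_ofContinuous (Complex.continuous_ofReal.comp hg.continuous) hd
      fun x => ((hg₁.differentiable one_ne_zero) x).hasDerivAt.ofReal_comp
    have h0 : ∀ x ∉ Ioo (0 : ℝ) 1, g x = 0 := fun x hx =>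
      image_eq_zero_of_notMem_tsupport fun h => hx (hsupp h)
    have := hu _ ⟨_, _, hrep, by simp [h0 0], by simp [h0 1]⟩
    rw [L2.inner_def] at this
    rw [← this]
    refine integral_congr_ae ?_
    filter_upwards [coeFn_ofContinuous (Complex.continuous_ofReal.comp hg.continuous)] with x hx
    rw [hx]
    simp [RCLike.inner_apply, mul_comm]
  refine Lp.ext ?_
  filter_upwards [key, ae_restrict_mem measurableSet_Ioo, Lp.coeFn_zero ℂ 2
    (volume.restrict (Ioo (0 : ℝ) 1))] with x h₁ h₂ h₃
  rw [h₁ h₂, h₃]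
  rfl

end HilbertModule

namespace HilbertModule

/-! ### The graph of `t` and its closedness. -/

theorem isACRep_acDeriv {f : L2} (h : f ∈ D0) : ∃ F, IsACRep F f (acDeriv f) ∧ F 0 = F 1 := by
  obtain ⟨F, g, h, e⟩ := h
  exact ⟨F, by rwa [acDeriv_eq h], e⟩

theorem t_apply (f : t.domain) (p : I) : t f p = Complex.I • acDeriv ((f : ModuleE) p) := rfl

theorem mem_D0_of_mem_domain (f : t.domain) (p : I) : (f : ModuleE) p ∈ D0 :=
  mem_D0_of_fibres f.2.1 f.2.2.1 p

/-- Continuity of the derivative in `π` needs no separate clause: the derivative is `-i g` with `g`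
in the module. This leaves only conditions on single fibres. -/
theorem mem_graph_t_iff {f g : ModuleE} :
    (f, g) ∈ t.graph ↔
      (∃ F, IsACRep F (f 0) (-Complex.I • g 0) ∧ F 0 = 0 ∧ F 1 = 0) ∧
        ∀ p, ∃ F, IsACRep F (f p) (-Complex.I • g p) ∧ F 0 = F 1 := by
  constructor
  · intro h
    obtain ⟨x, rfl, rfl⟩ := (LinearPMap.mem_graph_iff t).1 h
    simp only [t_apply, smul_smul, neg_mul, Complex.I_mul_I, neg_neg, one_smul]
    refine ⟨?_, fun p => isACRep_acDeriv (mem_D0_of_mem_domain x p)⟩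
    obtain ⟨F, g, h, e⟩ := x.2.1
    exact ⟨F, by rwa [acDeriv_eq h], e⟩
  · rintro ⟨⟨F, hF, e⟩, h⟩
    have hd : ∀ p, acDeriv (f p) = -Complex.I • g p := fun p => by
      obtain ⟨F, hF, -⟩ := h p
      exact acDeriv_eq hF
    have hf : f ∈ t.domain := by
      refine ⟨⟨F, _, hF, e⟩, fun p _ => ?_, ?_⟩
      · obtain ⟨F, hF, e⟩ := h p
        exact ⟨F, _, hF, e⟩
      · simp only [hd]
        fun_prop
    refine (LinearPMap.mem_graph_iff t).2 ⟨⟨f, hf⟩, rfl, ?_⟩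
    ext1 p
    rw [t_apply, hd, smul_smul]
    simp

theorem isClosed_t : t.IsClosed := by
  have : (t.graph : Set (ModuleE × ModuleE)) =
      (fun q : ModuleE × ModuleE => (q.1 0, -Complex.I • q.2 0)) ⁻¹'
          {q : L2 × L2 | ∃ F, IsACRep F q.1 q.2 ∧ F 0 = 0 ∧ F 1 = 0} ∩
        ⋂ p, (fun q : ModuleE × ModuleE => (q.1 p, -Complex.I • q.2 p)) ⁻¹'
          {q : L2 × L2 | ∃ F, IsACRep F q.1 q.2 ∧ F 0 = F 1} := by
    ext ⟨f, g⟩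
    simp only [SetLike.mem_coe, mem_graph_t_iff, mem_inter_iff, mem_preimage, mem_iInter,
      mem_ofPred_eq]
  rw [LinearPMap.IsClosed, this]
  exact (isClosed_dirichlet_graph.preimage (by fun_prop)).inter
    (isClosed_iInter fun p => isClosed_periodic_graph.preimage (by fun_prop))

/-! ### Dense domains and semiregularity. -/

theorem acDeriv_smul_of_rep {F : ℝ → ℂ} {f g : L2} (h : IsACRep F f g) (c : ℂ) :
    acDeriv (c • f) = c • g :=
  acDeriv_eq (h.smul c)

/-- A tensor `a ⊗ h` with `h ∈ D₀` lies in the domain of `t` if its fibre at `0` is in `D₀₀`. -/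
theorem tensor_mem_domain {a : C(I, ℂ)} {h : L2} (hh : h ∈ D0) (h₀ : a 0 • h ∈ D00) :
    tensor a h ∈ t.domain := by
  refine ⟨h₀, fun p _ => D0.smul_mem (a p) hh, ?_⟩
  obtain ⟨F, g, hF, -⟩ := hh
  have : (fun p => acDeriv (tensor a h p)) = fun p => a p • g :=
    funext fun p => acDeriv_smul_of_rep hF (a p)
  rw [this]
  fun_prop

theorem continuous_tensor (a : C(I, ℂ)) : Continuous (tensor a) :=
  ContinuousMap.continuous_of_continuous_uncurry _
    (show Continuous fun q : L2 × I => a q.2 • q.1 by fun_prop)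

/-- A subspace of `E` containing all `a ⊗ h` with `h ∈ D₀₀` is dense. -/
theorem dense_of_tensor_mem {S : Submodule ℂ ModuleE} (hS : ∀ a, ∀ h ∈ D00, tensor a h ∈ S) :
    Dense (S : Set ModuleE) := by
  have h₁ : Submodule.span ℂ {f : ModuleE | ∃ a h, f = tensor a h} ≤ S.topologicalClosure := by
    refine Submodule.span_le.2 ?_
    rintro _ ⟨a, h, rfl⟩
    exact map_mem_closure (continuous_tensor a) (dense_D00 h) fun k hk => hS a k hk
  have h₂ := dense_span_tensor.mono h₁
  rw [Submodule.topologicalClosure_coe] at h₂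
  exact dense_closure.1 h₂

theorem dense_domain_t : Dense (t.domain : Set ModuleE) :=
  dense_of_tensor_mem fun a _ hh => tensor_mem_domain (D00_le_D0 hh) (D00.smul_mem (a 0) hh)

theorem smul_mem_domain_t (a : C(I, ℂ)) {x : ModuleE} (hx : x ∈ t.domain) :
    a • x ∈ t.domain := by
  refine ⟨D00.smul_mem (a 0) hx.1, fun p hp => D0.smul_mem (a p) (hx.2.1 p hp), ?_⟩
  have : (fun p => acDeriv ((a • x) p)) = fun p => a p • acDeriv (x p) :=
    funext fun p => acDeriv_smul (a p) (mem_D0_of_mem_domain ⟨x, hx⟩ p)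
  rw [this]
  exact a.continuous.smul hx.2.2

theorem dense_adjoint_domain_t : Dense ((adjoint C(I, ℂ) t).domain : Set ModuleE) := by
  refine dense_of_tensor_mem fun a h hh => ?_
  obtain ⟨H, k, hH, e₀, e₁⟩ := hh
  -- The adjoint also acts as `i d/dx`; the boundary terms vanish because `H` does at both ends.
  refine ⟨(tensor a h, tensor a (Complex.I • k)), fun x => ?_, rfl⟩
  ext p
  obtain ⟨F, hF, -⟩ := isACRep_acDeriv (mem_D0_of_mem_domain x p)
  have := hF.inner_add_inner hH
  rw [e₀, e₁] at this
  simp only [inner_apply, t_apply, tensor, ContinuousMap.coe_mk, inner_smul_left,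
    inner_smul_right, Complex.conj_I]
  linear_combination (-Complex.I * a p) * this

theorem isSemiregular_t : IsSemiregular C(I, ℂ) t where
  dense_domain := dense_domain_t
  smul_mem_domain a _ hx := smul_mem_domain_t a hx
  isClosable := isClosed_t.isClosable
  dense_adjoint_domain := dense_adjoint_domain_t

/-! ### Failure of regularity in the fibre at `0`. -/

theorem apply_zero_eq_of_forall_pos {u v : I → ℂ} (hu : Continuous u) (hv : Continuous v)
    (h : ∀ p : I, 0 < p → u p = v p) : u 0 = v 0 := by
  have : Dense {p : I | p ≠ 0} := dense_compl_singleton 0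
  exact congrFun (hu.ext_on this hv fun p hp => h p (unitInterval.pos_iff_ne_zero.2 hp)) 0

/-- The fibre at `0` of the adjoint of `t` satisfies periodic boundary conditions. -/
theorem inner_fibre_zero_of_mem_adjointGraph {y z : ModuleE}
    (hyz : (y, z) ∈ adjointGraph C(I, ℂ) t) {K : ℝ → ℂ} {k l : L2} (hK : IsACRep K k l)
    (e : K 0 = K 1) : ⟪Complex.I • l, y 0⟫_ℂ = ⟪k, z 0⟫_ℂ := by
  -- The factor `a π = π` kills the fibre at `0`, so `a ⊗ k` is in the domain for every periodic
  -- `k`; for `π > 0` it can be cancelled.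
  let a : C(I, ℂ) := ⟨fun p => ((p : ℝ) : ℂ), by fun_prop⟩
  have ha : tensor a k ∈ t.domain := by
    refine tensor_mem_domain ⟨K, l, hK, e⟩ ?_
    simp [a]
  refine apply_zero_eq_of_forall_pos (u := fun p => ⟪Complex.I • l, y p⟫_ℂ)
    (v := fun p => ⟪k, z p⟫_ℂ) (by fun_prop) (by fun_prop) fun p hp => ?_
  have h₁ := congrArg (fun u : C(I, ℂ) => u p) (hyz ⟨_, ha⟩)
  have hap : (starRingEnd ℂ) (a p) ≠ 0 := by
    simpa [a] using hp.ne'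
  simp only [inner_apply, t_apply] at h₁
  change ⟪Complex.I • acDeriv (a p • k), y p⟫_ℂ = ⟪a p • k, z p⟫_ℂ at h₁
  rw [acDeriv_smul_of_rep hK, smul_comm, inner_smul_left _ _ (a p), inner_smul_left _ _ (a p)] at h₁
  exact mul_left_cancel₀ hap h₁

/-- `I + t⋆ t` acts on the fibre at `0` as `f ↦ f - f''` with `f 0 = f 1 = 0` and `f' 0 = f' 1`, so
its range is orthogonal to every periodic solution `k` of `k'' = k`. -/
theorem inner_rangeOneAddAdjointMul {K L : ℝ → ℂ} {k l : L2} (hK : IsACRep K k l)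
    (hL : IsACRep L l k) (e : K 0 = K 1) {z : ModuleE}
    (hz : z ∈ rangeOneAddAdjointMul C(I, ℂ) t) : ⟪k, z 0⟫_ℂ = 0 := by
  obtain ⟨x, hx, rfl⟩ := hz
  have hg : (t x, adjoint C(I, ℂ) t ⟨t x, hx⟩) ∈ adjointGraph C(I, ℂ) t := by
    rw [← adjoint_graph C(I, ℂ) t dense_domain_t]
    exact LinearPMap.mem_graph _ (⟨t x, hx⟩ : (adjoint C(I, ℂ) t).domain)
  have h₁ := inner_fibre_zero_of_mem_adjointGraph hg hK e
  obtain ⟨F, g, hF, e₀, e₁⟩ := x.2.1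
  -- `L` need not be periodic here, because `F` vanishes at both ends.
  have h₂ := hL.inner_add_inner hF
  rw [t_apply, acDeriv_eq hF, inner_smul_left, inner_smul_right, Complex.conj_I] at h₁
  rw [e₀, e₁] at h₂
  rw [ContinuousMap.add_apply, inner_add_right, ← h₁]
  linear_combination h₂ - ⟪l, g⟫_ℂ * Complex.I_mul_I

theorem not_dense_rangeOneAddAdjointMul_t :
    ¬ Dense (rangeOneAddAdjointMul C(I, ℂ) t) := by
  intro hd
  -- `K` is symmetric under `x ↦ 1 - x`, hence periodic; `L` is its derivative, and `L' = K`.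
  let K : ℝ → ℂ := fun x => Real.exp x + Real.exp (1 - x)
  let L : ℝ → ℂ := fun x => Real.exp x - Real.exp (1 - x)
  have hK : Continuous K := by fun_prop
  have hL : Continuous L := by fun_prop
  have d₁ : ∀ x, HasDerivAt (fun x : ℝ => (Real.exp x : ℂ)) (Real.exp x) x := fun x =>
    (Real.hasDerivAt_exp x).ofReal_comp
  have d₂ : ∀ x, HasDerivAt (fun x : ℝ => (Real.exp (1 - x) : ℂ)) (-Real.exp (1 - x)) x :=
    fun x => by
      simpa using! (((hasDerivAt_id x).const_sub 1).exp).ofReal_comp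
  have hKL := isACRep_ofContinuous hK hL fun x => by
    convert! (d₁ x).add (d₂ x) using 1
  have hLK := isACRep_ofContinuous hL hK fun x => by
    convert! (d₁ x).sub (d₂ x) using 1
    exact (sub_neg_eq_add _ _).symm
  set k := ofContinuous K hK
  have h₀ : ∀ f : ModuleE, ⟪k, f 0⟫_ℂ = 0 := congrFun <|
    Continuous.ext_on (f := fun f : ModuleE => ⟪k, f 0⟫_ℂ) (g := fun _ => 0) hd
      (by fun_prop) continuous_const
      fun z hz => inner_rangeOneAddAdjointMul hKL hLK (by simp [K, add_comm]) hz
  -- The constant section `k` gives `⟪k, k⟫ = 0`, whereas `K 0 = 1 + e > 0`.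
  have hk : k = 0 := inner_self_eq_zero.1 (h₀ (ContinuousMap.const I k))
  have hEq : EqOn K 0 (Icc 0 1) := (hk ▸ hKL).eqOn .zero
  have := hEq (left_mem_Icc.2 zero_le_one)
  simp only [K, Pi.zero_apply, ← Complex.ofReal_add, Complex.ofReal_eq_zero] at this
  have h₁ := Real.exp_pos 0
  have h₂ := Real.exp_pos (1 - 0)
  linarith

end HilbertModule

end

theorem proposition2p2 :
    HilbertModule.t.IsClosed ∧
      HilbertModule.IsSemiregular C(unitInterval, ℂ) HilbertModule.t ∧
      ¬ HilbertModule.IsRegular C(unitInterval, ℂ) HilbertModule.t :=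
  ⟨HilbertModule.isClosed_t, HilbertModule.isSemiregular_t,
    fun h => HilbertModule.not_dense_rangeOneAddAdjointMul_t h.dense_range⟩
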